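/- Let $m\ge 1$, let $\lambda_1,\dots,\lambda_{m-1}\in\mathbb C$ and $R_1,\dots,R_{m-1}>0$, and put $$S=\{z\in\mathbb C : |z|\le 1,\ |z-\lambda_j|\ge R_j,\ j=1,\dots,m-1\}.$$ Let $p(z,\bar z)=\sum_{k,l}p_{kl}z^k\bar z^l$ be a polynomial with complex coefficients, let $p(S)=\{p(z,\bar z): z\in S\}$, and for an element $a$ of a unital $C^*$-algebra $\mathcal A$ put $p(a,a^*)=\sum_{k,l}p_{kl}a^k(a^*)^l$. For $r>0$ and $b\in\mathcal A$ let $$\sigma_r(b)=\{\mu\in\mathbb C:\ \|(b-\mu\mathbf 1)^{-1}\|>1/r\}\cup\sigma(b)$$ be the $r$-pseudospectrum of $b$, and let $\mathcal O_\kappa(M)=\{\mu\in\mathbb C:\operatorname{dist}(\mu,M)<\kappa\}$ be the open $\kappa$-neighbourhood of $M\subset\mathbb C$ (with $\mathcal O_\kappa(\varnothing)=\varnothing$). Then for all $\varepsilon>0$ and $\kappa>0$ there exist constants $C\ge 0$ and $\delta_0>0$, depending only on $p,\kappa,\varepsilon$ and on the $\lambda_j,R_j$, such that for every unital $C^*$-algebra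 $\mathcal A$, every real $\delta<\delta_0$, and every $a\in\mathcal A$ such that $$\|a\|\le 1,\qquad \|aa^*-a^*a\|\le\delta,\qquad a-\lambda_j\mathbf 1\ \text{is invertible and}\ \|(a-\lambda_j\mathbf 1)^{-1}\|\le R_j^{-1}\quad (j=1,\dots,m-1),$$ one has $$\sigma_{\kappa'}(p(a,a^*))\subset\mathcal O_\kappa(p(S)),\qquad\text{where } (\kappa')^{-1}=\kappa^{-1}+\varepsilon+C\delta .$$ -/

import Mathlib

open scoped ComplexConjugate

/-- A polynomial `p(z, z̄) = ∑ p_{kl} z^k z̄^l`, encoded as an element of `ℂ[X₀, X₁]`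
(`X₀` stands for `z`, `X₁` for `z̄`), considered as a map from `ℂ` to `ℂ`. -/
noncomputable def polyMap (p : MvPolynomial (Fin 2) ℂ) (z : ℂ) : ℂ :=
  MvPolynomial.eval ![z, conj z] p

/-- The element `p(a, a*) = ∑ p_{kl} a^k (a*)^l`, with all powers of `a` to the left of the
powers of `a*`. -/
noncomputable def polyStar {A : Type*} [CStarAlgebra A] (p : MvPolynomial (Fin 2) ℂ) (a : A) : A :=
  ∑ s ∈ p.support, p.coeff s • (a ^ s 0 * star a ^ s 1)

/-- The closed unit disk with the open disks of centres `lam j` and radii `R j` removed. -/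
def holedDisk {n : ℕ} (lam : Fin n → ℂ) (R : Fin n → ℝ) : Set ℂ :=
  {z | ‖z‖ ≤ 1 ∧ ∀ j, R j ≤ ‖z - lam j‖}

/-- The `r`-pseudospectrum `{z : ‖(a - z)⁻¹‖ > 1 / r} ∪ σ(a)`. (`Ring.inverse x` is the inverse of
`x` if `x` is invertible; the points where `a - z` is not invertible belong to `σ(a)`.) -/
noncomputable def pseudospectrum {A : Type*} [CStarAlgebra A] (r : ℝ) (a : A) : Set ℂ :=
  {z | 1 / r < ‖Ring.inverse (a - algebraMap ℂ A z)‖} ∪ spectrum ℂ a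

open Filter Topology
open scoped ENNReal

/-! ### Quotients of `C⋆`-algebras by closed two-sided ideals -/

namespace ClosedIdealQuotient

section General

variable {R : Type*} [NormedRing R] (I : Ideal R) [I.IsTwoSided]

/-! The proof is by contradiction and compactness, and it gives `C = 0`: the fixed slack `ε` absorbs
all the error once `δ` is small. If no `δ₀` worked, there would be algebras `A k`, elements `a k`
with commutators tending to zero, and bad points `μ k`. In the `C⋆`-algebra of bounded sequences
modulo null sequences the class of `a` is exactly normal, and the resolvent bounds put its spectrum
in the holed disk (`spectrum_modNull_subset_holedDisk`). The `μ k` are bounded, so a subsequence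
converges, and the continuous functional calculus inverts `p(a, a*) - ν` at the limit `ν` with norm
at most `κ⁻¹` (`exists_inverse_polyStar_sub`). A lift of this inverse is an approximate inverse
along the sequence, which a perturbation argument (`exists_inverse_of_approx`) makes exact at the
cost of `ε`, against the choice of `μ k`. -/

theorem norm_mk_le (r : R) : ‖Ideal.Quotient.mk I r‖ ≤ ‖r‖ :=
  Submodule.Quotient.norm_mk_le (S := I) r

theorem exists_norm_lt (x : R ⧸ I) {r : ℝ} (hr : ‖x‖ < r) :
    ∃ m : R, Ideal.Quotient.mk I m = x ∧ ‖m‖ < r := by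
  obtain ⟨m, hm, hlt⟩ := Submodule.Quotient.norm_mk_lt (S := I) x (sub_pos.2 hr)
  exact ⟨m, hm, by linarith⟩

theorem norm_mul_le (x y : R ⧸ I) : ‖x * y‖ ≤ ‖x‖ * ‖y‖ := by
  have key : ∀ η : ℝ, 0 < η → ‖x * y‖ ≤ (‖x‖ + η) * (‖y‖ + η) := by
    intro η hη
    obtain ⟨a, rfl, ha⟩ := exists_norm_lt I x (lt_add_of_pos_right _ hη)
    obtain ⟨b, rfl, hb⟩ := exists_norm_lt I y (lt_add_of_pos_right _ hη)
    rw [← map_mul]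
    calc _ ≤ ‖a * b‖ := norm_mk_le I _
      _ ≤ ‖a‖ * ‖b‖ := _root_.norm_mul_le a b
      _ ≤ _ := by gcongr
  have hc : Tendsto (fun η : ℝ => (‖x‖ + η) * (‖y‖ + η)) (𝓝[>] 0) (𝓝 (‖x‖ * ‖y‖)) := by
    have : Continuous (fun η : ℝ => (‖x‖ + η) * (‖y‖ + η)) := by fun_prop
    simpa using (this.tendsto 0).mono_left nhdsWithin_le_nhds
  exact ge_of_tendsto hc (eventually_mem_nhdsWithin.mono fun η hη => key η hη)

/-- The quotient of a normed ring by a closed two-sided ideal is a normed ring. -/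
noncomputable abbrev normedRing [IsClosed (I : Set R)] : NormedRing (R ⧸ I) :=
  { Submodule.Quotient.normedAddCommGroup I, Ideal.Quotient.ring I with
    norm_mul_le := norm_mul_le I }

end General

section Star

variable {R : Type*} [CStarAlgebra R] (I : Ideal R) [I.IsTwoSided]

/-- The involution on the quotient by a two-sided ideal closed under the involution. -/
abbrev starRing (hstar : ∀ x ∈ I, star x ∈ I) : StarRing (R ⧸ I) where
  star := Quotient.map' star fun x y hxy => by
    have h : x - y ∈ I := (Submodule.quotientRel_def I).1 hxy
    refine (Submodule.quotientRel_def I).2 ?_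
    rw [← star_sub]
    exact hstar _ h
  star_involutive x := by
    obtain ⟨x, rfl⟩ := Ideal.Quotient.mk_surjective x
    exact congrArg (Ideal.Quotient.mk I) (star_star x)
  star_mul x y := by
    obtain ⟨x, rfl⟩ := Ideal.Quotient.mk_surjective x
    obtain ⟨y, rfl⟩ := Ideal.Quotient.mk_surjective y
    exact congrArg (Ideal.Quotient.mk I) (star_mul x y)
  star_add x y := by
    obtain ⟨x, rfl⟩ := Ideal.Quotient.mk_surjective x
    obtain ⟨y, rfl⟩ := Ideal.Quotient.mk_surjective y
    exact congrArg (Ideal.Quotient.mk I) (star_add x y)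

/-- The quotient of a `C⋆`-algebra by a closed two-sided self-adjoint ideal whose quotient norm
satisfies the `C⋆`-inequality. -/
noncomputable abbrev cstarAlgebra [IsClosed (I : Set R)] (hstar : ∀ x ∈ I, star x ∈ I)
    (hnorm : ∀ x : R, ‖Ideal.Quotient.mk I x‖ * ‖Ideal.Quotient.mk I x‖ ≤
      ‖Ideal.Quotient.mk I (star x * x)‖) : CStarAlgebra (R ⧸ I) :=
  letI := normedRing I
  letI := starRing I hstar
  { normedRing I, starRing I hstar, Ideal.Quotient.algebra ℂ with
    norm_smul_le := (Submodule.Quotient.normedSpace I ℂ).norm_smul_le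
    complete := (Submodule.Quotient.completeSpace I).complete
    norm_mul_self_le := fun x => by
      obtain ⟨x, rfl⟩ := Ideal.Quotient.mk_surjective x
      exact hnorm x
    star_smul := fun c x => by
      obtain ⟨x, rfl⟩ := Ideal.Quotient.mk_surjective x
      exact congrArg (Ideal.Quotient.mk I) (star_smul c x) }

end Star

end ClosedIdealQuotient

/-! ### Bounded sequences modulo null sequences -/

section NullSequences

variable (A : ℕ → Type*) [∀ n, CStarAlgebra (A n)] [∀ n, Nontrivial (A n)]

/-- The `C⋆`-algebra of bounded sequences in a sequence of nontrivial `C⋆`-algebras. -/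
noncomputable instance boundedSeqCStarAlgebra : CStarAlgebra (lp A ∞) where

/-- The ideal of bounded sequences that tend to zero in norm. -/
noncomputable def nullSeq : Ideal (lp A ∞) where
  carrier := {x | Tendsto (fun n => ‖x n‖) atTop (𝓝 0)}
  add_mem' {x y} hx hy := squeeze_zero (fun n => norm_nonneg _)
    (fun n => norm_add_le (x n) (y n)) (by simpa using Tendsto.add hx hy)
  zero_mem' := by simp
  smul_mem' c x hx := squeeze_zero (fun n => norm_nonneg _)
    (fun n => (norm_mul_le (c n) (x n)).trans
      (mul_le_mul_of_nonneg_right (lp.norm_apply_le_norm ENNReal.top_ne_zero c n) (norm_nonneg _)))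
    (by simpa using Tendsto.const_mul ‖c‖ hx)

variable {A}

theorem mem_nullSeq {x : lp A ∞} :
    x ∈ nullSeq A ↔ Tendsto (fun n => ‖x n‖) atTop (𝓝 0) := Iff.rfl

instance : (nullSeq A).IsTwoSided where
  mul_mem_of_left {x} c hx := squeeze_zero (fun n => norm_nonneg _)
    (fun n => (norm_mul_le (x n) (c n)).trans
      (mul_le_mul_of_nonneg_left (lp.norm_apply_le_norm ENNReal.top_ne_zero c n) (norm_nonneg _)))
    (by simpa using Tendsto.mul_const ‖c‖ hx)

theorem star_mem_nullSeq (x : lp A ∞) (hx : x ∈ nullSeq A) : star x ∈ nullSeq A := by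
  rw [mem_nullSeq] at hx ⊢
  simpa using hx

theorem eventually_norm_lt_of_mem_nullSeq {x : lp A ∞} (hx : x ∈ nullSeq A) {η : ℝ}
    (hη : 0 < η) : ∀ᶠ n in atTop, ‖x n‖ < η :=
  (mem_nullSeq.1 hx).eventually (gt_mem_nhds hη)

instance : IsClosed (nullSeq A : Set (lp A ∞)) := by
  refine isClosed_of_closure_subset fun x hx => ?_
  rw [SetLike.mem_coe, mem_nullSeq, NormedAddGroup.tendsto_nhds_zero]
  intro η hη
  obtain ⟨y, hy, hxy⟩ := Metric.mem_closure_iff.1 hx (η / 2) (half_pos hη)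
  filter_upwards [eventually_norm_lt_of_mem_nullSeq hy (half_pos hη)] with n hn
  have h1 : ‖x n - y n‖ ≤ ‖x - y‖ := lp.norm_apply_le_norm ENNReal.top_ne_zero (x - y) n
  rw [dist_eq_norm] at hxy
  have h2 := norm_le_norm_add_norm_sub (y n) (x n)
  rw [norm_norm]
  rw [norm_sub_rev] at h2
  linarith [norm_sub_rev (x n) (y n)]

/-- Zeroing finitely many terms does not change the class. With `eventually_norm_lt_of_norm_mk_lt`
this says that the quotient norm is the limsup of `‖x n‖`. -/
theorem norm_mk_nullSeq_le {x : lp A ∞} {r : ℝ} (hr : 0 ≤ r) (h : ∀ᶠ n in atTop, ‖x n‖ ≤ r) :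
    ‖Ideal.Quotient.mk (nullSeq A) x‖ ≤ r := by
  obtain ⟨N, hN⟩ := eventually_atTop.1 h
  have hmem : Memℓp (fun n => if N ≤ n then x n else 0) ∞ := by
    refine memℓp_infty ⟨r, ?_⟩
    rintro _ ⟨n, rfl⟩
    by_cases hn : N ≤ n
    · simpa [hn] using hN n hn
    · simpa [hn] using hr
  have heq : Ideal.Quotient.mk (nullSeq A) x = Ideal.Quotient.mk (nullSeq A) ⟨_, hmem⟩ := by
    rw [Ideal.Quotient.mk_eq_mk_iff_sub_mem, mem_nullSeq]
    refine tendsto_const_nhds.congr' ?_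
    filter_upwards [eventually_ge_atTop N] with n hn
    change 0 = ‖x n - (if N ≤ n then x n else 0)‖
    simp [hn]
  rw [heq]
  refine (ClosedIdealQuotient.norm_mk_le _ _).trans (lp.norm_le_of_forall_le hr fun n => ?_)
  by_cases hn : N ≤ n
  · simpa [hn] using hN n hn
  · simpa [hn] using hr

theorem eventually_norm_lt_of_norm_mk_lt {x : lp A ∞} {r : ℝ}
    (h : ‖Ideal.Quotient.mk (nullSeq A) x‖ < r) : ∀ᶠ n in atTop, ‖x n‖ < r := by
  obtain ⟨y, hy, hlt⟩ := ClosedIdealQuotient.exists_norm_lt _ _ h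
  rw [Ideal.Quotient.mk_eq_mk_iff_sub_mem] at hy
  filter_upwards [eventually_norm_lt_of_mem_nullSeq hy (sub_pos.2 hlt)] with n hn
  have h1 : ‖y n‖ ≤ ‖y‖ := lp.norm_apply_le_norm ENNReal.top_ne_zero y n
  have h2 : ‖y n - x n‖ < r - ‖y‖ := hn
  have h3 := norm_sub_norm_le (x n) (y n)
  rw [norm_sub_rev] at h3
  linarith

/-- The `C⋆`-algebra of bounded sequences modulo null sequences. -/
noncomputable instance : CStarAlgebra (lp A ∞ ⧸ nullSeq A) :=
  ClosedIdealQuotient.cstarAlgebra (nullSeq A) star_mem_nullSeq fun x => by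
    set t := ‖Ideal.Quotient.mk (nullSeq A) (star x * x)‖
    -- The quotient norm only sees the tail, so the `C⋆`-identity is inherited from the coordinates.
    have key : ∀ r, t < r → ‖Ideal.Quotient.mk (nullSeq A) x‖ * ‖Ideal.Quotient.mk (nullSeq A) x‖ ≤ r := by
      intro r hr
      have hr0 : 0 ≤ r := (norm_nonneg _).trans hr.le
      have hx : ‖Ideal.Quotient.mk (nullSeq A) x‖ ≤ √r := by
        refine norm_mk_nullSeq_le (Real.sqrt_nonneg _) ?_
        filter_upwards [eventually_norm_lt_of_norm_mk_lt hr] with n hn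
        refine Real.le_sqrt_of_sq_le ?_
        rw [sq, ← CStarRing.norm_star_mul_self]
        exact hn.le
      calc _ ≤ √r * √r := by gcongr
        _ = r := Real.mul_self_sqrt hr0
    exact le_of_forall_gt_imp_ge_of_dense key

variable (A) in
/-- The quotient map from bounded sequences to bounded sequences modulo null sequences. -/
noncomputable def modNull : lp A ∞ →⋆ₐ[ℂ] (lp A ∞ ⧸ nullSeq A) where
  toFun := Ideal.Quotient.mk (nullSeq A)
  map_one' := rfl
  map_mul' _ _ := rfl
  map_zero' := rfl
  map_add' _ _ := rfl
  commutes' _ := rfl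
  map_star' _ := rfl

theorem norm_modNull_le {x : lp A ∞} {r : ℝ} (hr : 0 ≤ r) (h : ∀ n, ‖x n‖ ≤ r) :
    ‖modNull A x‖ ≤ r :=
  norm_mk_nullSeq_le hr (.of_forall h)

theorem modNull_eq_zero {x : lp A ∞} :
    modNull A x = 0 ↔ Tendsto (fun n => ‖x n‖) atTop (𝓝 0) :=
  Ideal.Quotient.eq_zero_iff_mem.trans mem_nullSeq

theorem exists_modNull_eq_norm_lt (y : lp A ∞ ⧸ nullSeq A) {r : ℝ} (h : ‖y‖ < r) :
    ∃ x : lp A ∞, modNull A x = y ∧ ‖x‖ < r :=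
  ClosedIdealQuotient.exists_norm_lt _ y h

theorem polyStar_apply (p : MvPolynomial (Fin 2) ℂ) (x : lp A ∞) (n : ℕ) :
    polyStar p x n = polyStar p (x n) := by
  simp only [polyStar]
  rw [lp.coeFn_sum, Finset.sum_apply]
  refine Finset.sum_congr rfl fun s _ => ?_
  rw [lp.coeFn_smul, Pi.smul_apply, lp.infty_coeFn_mul, Pi.mul_apply, lp.infty_coeFn_pow,
    lp.infty_coeFn_pow, Pi.pow_apply, Pi.pow_apply, lp.star_apply]

end NullSequences

/-! ### Spectrum and functional calculus of the limit element -/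

section Normal

variable {A B : Type*} [CStarAlgebra A] [CStarAlgebra B]

theorem map_polyStar (φ : A →⋆ₐ[ℂ] B) (p : MvPolynomial (Fin 2) ℂ) (a : A) :
    φ (polyStar p a) = polyStar p (φ a) := by
  simp only [polyStar, map_sum, map_smul, map_mul, map_pow, map_star]

theorem continuous_polyMap (p : MvPolynomial (Fin 2) ℂ) : Continuous (polyMap p) := by
  unfold polyMap
  simp only [MvPolynomial.eval_eq', Fin.prod_univ_two]
  simp
  fun_prop

theorem cfc_polyMap (p : MvPolynomial (Fin 2) ℂ) (a : A) [IsStarNormal a] :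
    cfc (polyMap p) a = polyStar p a := by
  have : polyMap p = ∑ s ∈ p.support, fun z => p.coeff s • (z ^ s 0 * (star z) ^ s 1) := by
    ext z
    simp [polyMap, MvPolynomial.eval_eq', Fin.prod_univ_two]
  rw [this, cfc_sum _ _ _ (fun s _ => by fun_prop), polyStar]
  refine Finset.sum_congr rfl fun s _ => ?_
  rw [cfc_smul _ _ a (by fun_prop), cfc_mul _ _ a (by fun_prop) (by fun_prop),
    cfc_pow _ _ a (by fun_prop), cfc_pow _ _ a (by fun_prop), cfc_star_id (a := a), cfc_id' ℂ a]

/-- If `z` were closer to `w`, then `a - z = (1 - (z - w) b)(a - w)` would be invertible by a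
Neumann series. -/
theorem norm_sub_inv_le_of_mem_spectrum {a : A} {w z : ℂ} {r : ℝ} (hr : 0 < r)
    {b : A} (hab : (a - algebraMap ℂ A w) * b = 1) (hba : b * (a - algebraMap ℂ A w) = 1)
    (hb : ‖b‖ ≤ r⁻¹) (hz : z ∈ spectrum ℂ a) : r ≤ ‖z - w‖ := by
  by_contra! hlt
  refine hz ?_
  have hu : IsUnit (a - algebraMap ℂ A w) := ⟨⟨_, b, hab, hba⟩, rfl⟩
  have hlt1 : ‖algebraMap ℂ A (z - w) * b‖ < 1 := by
    rw [← Algebra.smul_def, norm_smul]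
    calc ‖z - w‖ * ‖b‖ ≤ ‖z - w‖ * r⁻¹ := by gcongr
      _ < r * r⁻¹ := by gcongr
      _ = 1 := mul_inv_cancel₀ hr.ne'
  have heq : algebraMap ℂ A z - a =
      -((1 - algebraMap ℂ A (z - w) * b) * (a - algebraMap ℂ A w)) := by
    rw [sub_mul, mul_assoc, hba, map_sub]
    simp
  change IsUnit (algebraMap ℂ A z - a)
  rw [heq]
  exact ((isUnit_one_sub_of_norm_lt_one hlt1).mul hu).neg

theorem exists_inverse_polyStar_sub (p : MvPolynomial (Fin 2) ℂ) (a : A) [IsStarNormal a] (μ : ℂ)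
    {κ : ℝ} (hκ : 0 < κ) (h : ∀ z ∈ spectrum ℂ a, κ ≤ ‖polyMap p z - μ‖) :
    ∃ b : A, (polyStar p a - algebraMap ℂ A μ) * b = 1 ∧
      b * (polyStar p a - algebraMap ℂ A μ) = 1 ∧ ‖b‖ ≤ κ⁻¹ := by
  have hc := continuous_polyMap p
  have hne : ∀ z ∈ spectrum ℂ a, polyMap p z - μ ≠ 0 := fun z hz h0 => by
    have := h z hz
    rw [h0, norm_zero] at this
    linarith
  have hinv : ContinuousOn (fun z => (polyMap p z - μ)⁻¹) (spectrum ℂ a) :=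
    (by fun_prop : ContinuousOn (fun z => polyMap p z - μ) (spectrum ℂ a)).inv₀ hne
  have hsub : polyStar p a - algebraMap ℂ A μ = cfc (fun z => polyMap p z - μ) a := by
    rw [cfc_sub (fun z => polyMap p z) (fun _ => μ) a, cfc_const μ a, ← cfc_polyMap]
  refine ⟨cfc (fun z => (polyMap p z - μ)⁻¹) a, ?_, ?_, ?_⟩
  · rw [hsub, ← cfc_mul _ _ a (by fun_prop) hinv, ← cfc_one ℂ a]
    exact cfc_congr fun z hz => mul_inv_cancel₀ (hne z hz)
  · rw [hsub, ← cfc_mul _ _ a hinv (by fun_prop), ← cfc_one ℂ a]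
    exact cfc_congr fun z hz => inv_mul_cancel₀ (hne z hz)
  · refine norm_cfc_le (by positivity) fun z hz => ?_
    rw [norm_inv]
    exact inv_anti₀ hκ (h z hz)

end Normal

/-! ### Pseudospectra and approximate inverses -/

section Inverses

variable {A : Type*} [CStarAlgebra A]

theorem norm_polyStar_le (p : MvPolynomial (Fin 2) ℂ) {a : A} [Nontrivial A] (ha : ‖a‖ ≤ 1) :
    ‖polyStar p a‖ ≤ ∑ s ∈ p.support, ‖p.coeff s‖ := by
  refine norm_sum_le_of_le _ fun s _ => ?_
  have h1 : ‖a ^ s 0‖ ≤ 1 := (norm_pow_le a _).trans (pow_le_one₀ (norm_nonneg _) ha)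
  have h2 : ‖star a ^ s 1‖ ≤ 1 :=
    (norm_pow_le _ _).trans (pow_le_one₀ (norm_nonneg _) (by rwa [norm_star]))
  rw [norm_smul]
  exact mul_le_of_le_one_right (norm_nonneg _)
    ((norm_mul_le _ _).trans (mul_le_one₀ h1 (norm_nonneg _) h2))

theorem inv_lt_norm_of_mem_pseudospectrum {b c : A} {z : ℂ} {r : ℝ} (hz : z ∈ pseudospectrum r b)
    (hbc : (b - algebraMap ℂ A z) * c = 1) (hcb : c * (b - algebraMap ℂ A z) = 1) :
    r⁻¹ < ‖c‖ := by
  let u : Aˣ := ⟨b - algebraMap ℂ A z, c, hbc, hcb⟩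
  rcases hz with hz | hz
  · have : Ring.inverse (b - algebraMap ℂ A z) = c := Ring.inverse_unit u
    simpa [this] using hz
  · exact absurd (IsUnit.sub_iff.1 u.isUnit) hz

/-- In the zero algebra `0` is an inverse of norm `0`, so the pseudospectrum is empty. -/
theorem nontrivial_of_mem_pseudospectrum {b : A} {z : ℂ} {r : ℝ} (hr : 0 ≤ r⁻¹)
    (hz : z ∈ pseudospectrum r b) : Nontrivial A := by
  by_contra h
  have := not_nontrivial_iff_subsingleton.1 h
  have h1 := inv_lt_norm_of_mem_pseudospectrum (c := 0) hz (Subsingleton.elim _ _)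
    (Subsingleton.elim _ _)
  rw [norm_zero] at h1
  linarith

/-- Off the spectrum, `z c = b c - 1` for the resolvent `c`, whose norm exceeds `κ⁻¹`. The bound
confines the bad points `μ k` to a fixed disk. -/
theorem norm_le_of_mem_pseudospectrum [Nontrivial A] {b : A} {z : ℂ} {r κ : ℝ} (hκ : 0 < κ)
    (hr : κ⁻¹ ≤ r⁻¹) (hz : z ∈ pseudospectrum r b) : ‖z‖ ≤ ‖b‖ + κ := by
  by_contra! hlt
  have hu : IsUnit (b - algebraMap ℂ A z) := by
    by_contra hn
    have hmem : z ∈ spectrum ℂ b := fun h => hn (IsUnit.sub_iff.1 h)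
    linarith [spectrum.norm_le_norm_of_mem hmem]
  obtain ⟨u, hu⟩ := hu
  have h1 : (b - algebraMap ℂ A z) * (↑u⁻¹ : A) = 1 := by rw [← hu, u.mul_inv]
  have h2 := inv_lt_norm_of_mem_pseudospectrum hz h1 (by rw [← hu, u.inv_mul])
  set c : A := ↑u⁻¹
  have h3 : z • c = b * c - 1 := by
    rw [← h1, sub_mul, Algebra.smul_def]
    abel
  have h4 : ‖z‖ * ‖c‖ ≤ ‖b‖ * ‖c‖ + 1 := by
    rw [← norm_smul, h3]
    calc _ ≤ ‖b * c‖ + ‖(1 : A)‖ := norm_sub_le _ _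
      _ ≤ _ := by
        rw [CStarRing.norm_one]
        gcongr
        exact norm_mul_le _ _
  have h5 : 1 < κ * ‖c‖ := by
    rw [← mul_inv_cancel₀ hκ.ne']
    gcongr
    linarith
  nlinarith [norm_nonneg c]

/-- Both `b c` and `c b` are invertible, hence so is `b`; the norm bound comes from `d = c - d (b c
- 1)`. -/
theorem exists_inverse_of_approx {b c : A} {θ : ℝ} (hθ : θ < 1) (hbc : ‖b * c - 1‖ ≤ θ)
    (hcb : ‖c * b - 1‖ ≤ θ) :
    ∃ d : A, b * d = 1 ∧ d * b = 1 ∧ (1 - θ) * ‖d‖ ≤ ‖c‖ := by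
  have h1 : IsUnit (b * c) := by
    have := isUnit_one_sub_of_norm_lt_one (x := 1 - b * c) (by rw [norm_sub_rev]; linarith)
    simpa using this
  have h2 : IsUnit (c * b) := by
    have := isUnit_one_sub_of_norm_lt_one (x := 1 - c * b) (by rw [norm_sub_rev]; linarith)
    simpa using this
  have hb : IsUnit b := by
    obtain ⟨u, hu⟩ := h1
    obtain ⟨v, hv⟩ := h2
    refine isUnit_iff_exists_and_exists.2 ⟨⟨c * ↑u⁻¹, ?_⟩, ⟨↑v⁻¹ * c, ?_⟩⟩
    · rw [← mul_assoc, ← hu, u.mul_inv]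
    · rw [mul_assoc, ← hv, v.inv_mul]
  obtain ⟨u, rfl⟩ := hb
  refine ⟨↑u⁻¹, u.mul_inv, u.inv_mul, ?_⟩
  set d : A := ↑u⁻¹
  have h3 : d = c - d * (u * c - 1) := by
    rw [mul_sub, ← mul_assoc, u.inv_mul]
    simp
  have h4 : ‖d‖ ≤ ‖c‖ + ‖d‖ * θ := by
    calc ‖d‖ = ‖c - d * (u * c - 1)‖ := congrArg _ h3
      _ ≤ ‖c‖ + ‖d * (u * c - 1)‖ := norm_sub_le _ _
      _ ≤ ‖c‖ + ‖d‖ * ‖u * c - 1‖ := by gcongr; exact norm_mul_le _ _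
      _ ≤ _ := by gcongr
  linarith

end Inverses

/-! ### Passage to the limit algebra and back -/

section Limit

variable {A : ℕ → Type*} [∀ n, CStarAlgebra (A n)] [∀ n, Nontrivial (A n)]

/-- A bounded sequence of elements as an element of the algebra of bounded sequences. -/
noncomputable def boundedSeq (x : ∀ n, A n) {r : ℝ} (h : ∀ n, ‖x n‖ ≤ r) : lp A ∞ :=
  ⟨x, memℓp_infty ⟨r, by rintro _ ⟨n, rfl⟩; exact h n⟩⟩

theorem modNull_eq_iff {x y : lp A ∞} :
    modNull A x = modNull A y ↔ Tendsto (fun n => ‖x n - y n‖) atTop (𝓝 0) := by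
  rw [← sub_eq_zero, ← map_sub, modNull_eq_zero]
  rfl

/-- The class of an asymptotically normal sequence of contractions with uniformly bounded
resolvents at the points `lam j` has its spectrum in the holed disk. -/
theorem spectrum_modNull_subset_holedDisk {m : ℕ} {lam : Fin m → ℂ} {R : Fin m → ℝ}
    (hR : ∀ j, 0 < R j) {a : ∀ n, A n} (ha : ∀ n, ‖a n‖ ≤ 1)
    (hinv : ∀ n j, IsUnit (a n - algebraMap ℂ (A n) (lam j)) ∧
      ‖Ring.inverse (a n - algebraMap ℂ (A n) (lam j))‖ ≤ (R j)⁻¹) :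
    spectrum ℂ (modNull A (boundedSeq a ha)) ⊆ holedDisk lam R := by
  intro z hz
  refine ⟨?_, fun j => ?_⟩
  · have hX : ‖modNull A (boundedSeq a ha)‖ ≤ 1 := norm_modNull_le zero_le_one ha
    have : Nontrivial (lp A ∞ ⧸ nullSeq A) := by
      by_contra h
      have := not_nontrivial_iff_subsingleton.1 h
      rw [spectrum.of_subsingleton] at hz
      exact hz
    exact (spectrum.norm_le_norm_of_mem hz).trans hX
  · let v : lp A ∞ := boundedSeq (fun n => Ring.inverse (a n - algebraMap ℂ (A n) (lam j)))
      (fun n => (hinv n j).2)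
    refine norm_sub_inv_le_of_mem_spectrum (hR j) (b := modNull A v) ?_ ?_
      (norm_modNull_le (inv_nonneg.2 (hR j).le) fun n => (hinv n j).2) hz
    · rw [← AlgHomClass.commutes (modNull A) (lam j), ← map_sub, ← map_mul, ← map_one (modNull A)]
      congr 1
      ext n
      exact Ring.mul_inverse_cancel _ (hinv n j).1
    · rw [← AlgHomClass.commutes (modNull A) (lam j), ← map_sub, ← map_mul, ← map_one (modNull A)]
      congr 1
      ext n
      exact Ring.inverse_mul_cancel _ (hinv n j).1

theorem isStarNormal_modNull {a : ∀ n, A n} (ha : ∀ n, ‖a n‖ ≤ 1)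
    (hcomm : Tendsto (fun n => ‖a n * star (a n) - star (a n) * a n‖) atTop (𝓝 0)) :
    IsStarNormal (modNull A (boundedSeq a ha)) := by
  refine ⟨?_⟩
  rw [← map_star, commute_iff_eq, ← map_mul, ← map_mul, eq_comm, modNull_eq_iff]
  exact hcomm

/-- If an asymptotically normal sequence of contractions satisfies the resolvent bounds defining the
holed disk, then the resolvent of `polyStar p (a n)` at `μ n` has norm at most `κ⁻¹ + ε` for some
`n`, provided that `μ` converges and stays at distance `κ` from the image of the holed disk. -/
theorem exists_inverse_along_sequence {m : ℕ} {lam : Fin m → ℂ} {R : Fin m → ℝ}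
    (hR : ∀ j, 0 < R j) (p : MvPolynomial (Fin 2) ℂ) {ε κ : ℝ} (hε : 0 < ε) (hκ : 0 < κ)
    {a : ∀ n, A n} (ha : ∀ n, ‖a n‖ ≤ 1)
    (hcomm : Tendsto (fun n => ‖a n * star (a n) - star (a n) * a n‖) atTop (𝓝 0))
    (hinv : ∀ n j, IsUnit (a n - algebraMap ℂ (A n) (lam j)) ∧
      ‖Ring.inverse (a n - algebraMap ℂ (A n) (lam j))‖ ≤ (R j)⁻¹)
    {μ : ℕ → ℂ} {ν : ℂ} (hμ : Tendsto μ atTop (𝓝 ν))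
    (hdist : ∀ n, ∀ z ∈ holedDisk lam R, κ ≤ ‖polyMap p z - μ n‖) :
    ∃ n, ∃ d : A n, (polyStar p (a n) - algebraMap ℂ (A n) (μ n)) * d = 1 ∧
      d * (polyStar p (a n) - algebraMap ℂ (A n) (μ n)) = 1 ∧ ‖d‖ ≤ κ⁻¹ + ε := by
  set x := boundedSeq a ha
  have := isStarNormal_modNull ha hcomm
  have hlim : ∀ z ∈ spectrum ℂ (modNull A x), κ ≤ ‖polyMap p z - ν‖ := fun z hz =>
    ge_of_tendsto (tendsto_const_nhds.sub hμ).norm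
      (.of_forall fun n => hdist n z (spectrum_modNull_subset_holedDisk hR ha hinv hz))
  obtain ⟨w, hw1, hw2, hw⟩ := exists_inverse_polyStar_sub p (modNull A x) ν hκ hlim
  -- Half of `ε` is spent on lifting the inverse, the other half on making it exact.
  obtain ⟨c, rfl, hc⟩ := exists_modNull_eq_norm_lt w (r := κ⁻¹ + ε / 2) (by linarith)
  obtain ⟨M, hM⟩ := hμ.norm.bddAbove_range
  let mu : lp A ∞ := boundedSeq (fun n => algebraMap ℂ (A n) (μ n)) (r := M) fun n => by
    rw [norm_algebraMap']
    exact hM ⟨n, rfl⟩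
  -- Modulo null sequences the varying scalars `μ n` become the single scalar `ν`.
  have hmu : modNull A mu = algebraMap ℂ _ ν := by
    rw [← AlgHomClass.commutes (modNull A) ν, modNull_eq_iff]
    have : ∀ n, ‖mu n - (algebraMap ℂ (lp A ∞) ν) n‖ = ‖μ n - ν‖ := fun n => by
      change ‖algebraMap ℂ (A n) (μ n) - algebraMap ℂ (A n) ν‖ = _
      rw [← map_sub, norm_algebraMap']
    simpa only [this] using tendsto_iff_norm_sub_tendsto_zero.1 hμ
  have happ : ∀ n, (polyStar p x - mu) n = polyStar p (a n) - algebraMap ℂ (A n) (μ n) := fun n => by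
    rw [lp.coeFn_sub, Pi.sub_apply, polyStar_apply]
    rfl
  rw [← hmu, ← map_polyStar, ← map_sub, ← map_mul, ← map_one (modNull A), modNull_eq_iff] at hw1 hw2
  -- This `θ` solves `(1 - θ)(κ⁻¹ + ε) = κ⁻¹ + ε / 2`.
  set θ := ε / 2 / (κ⁻¹ + ε) with hθ
  have hκ' : 0 < κ⁻¹ := inv_pos.2 hκ
  have hθ0 : 0 < θ := by positivity
  have hθ1 : θ < 1 := by rw [hθ, div_lt_one (by positivity)]; linarith
  have hθ2 : (1 - θ) * (κ⁻¹ + ε) = κ⁻¹ + ε / 2 := by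
    rw [hθ, sub_mul, div_mul_cancel₀ _ (by positivity)]
    ring
  obtain ⟨n, h1, h2⟩ := ((hw1.eventually (ge_mem_nhds hθ0)).and
    (hw2.eventually (ge_mem_nhds hθ0))).exists
  rw [lp.infty_coeFn_mul, Pi.mul_apply, happ] at h1 h2
  obtain ⟨d, hd1, hd2, hd⟩ := exists_inverse_of_approx hθ1 h1 h2
  refine ⟨n, d, hd1, hd2, ?_⟩
  have hcn : ‖c n‖ ≤ ‖c‖ := lp.norm_apply_le_norm ENNReal.top_ne_zero c n
  refine le_of_mul_le_mul_left ?_ (sub_pos.2 hθ1)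
  rw [hθ2]
  linarith

end Limit

/-! ### The theorem, by contradiction -/

theorem mainTheorem6 {n : ℕ} (lam : Fin n → ℂ) (R : Fin n → ℝ) (hR : ∀ j, 0 < R j)
    (p : MvPolynomial (Fin 2) ℂ) (ε κ : ℝ) (hε : 0 < ε) (hκ : 0 < κ) :
    ∃ C δ₀ : ℝ, 0 ≤ C ∧ 0 < δ₀ ∧
      ∀ (A : Type*) [CStarAlgebra A] (a : A) (δ κ' : ℝ),
        δ < δ₀ →
        ‖a‖ ≤ 1 →
        ‖a * star a - star a * a‖ ≤ δ →
        (∀ j, IsUnit (a - algebraMap ℂ A (lam j)) ∧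
          ‖Ring.inverse (a - algebraMap ℂ A (lam j))‖ ≤ (R j)⁻¹) →
        κ'⁻¹ = κ⁻¹ + ε + C * δ →
        pseudospectrum κ' (polyStar p a) ⊆ Metric.thickening κ (polyMap p '' holedDisk lam R) := by

  by_contra hcon
  push Not at hcon
  -- Counterexamples are taken for `C = 0` and `δ₀ = 1 / (k + 1)`.
  choose A inst a δ κ' hδ ha hcomm hinv hκ' hsub using
    fun k : ℕ => hcon 0 (1 / ((k : ℝ) + 1)) le_rfl (by positivity)
  have hr : ∀ k, (κ' k)⁻¹ = κ⁻¹ + ε := fun k => by rw [hκ' k, zero_mul, add_zero]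
  have hκ0 : 0 < κ⁻¹ := inv_pos.2 hκ
  choose μ hμ hμS using fun k => Set.not_subset.1 (hsub k)
  have hnt : ∀ k, Nontrivial (A k) := fun k =>
    nontrivial_of_mem_pseudospectrum (by rw [hr]; positivity) (hμ k)
  have hbdd : ∀ k, μ k ∈ Metric.closedBall (0 : ℂ) ((∑ s ∈ p.support, ‖p.coeff s‖) + κ) :=
    fun k => by
      rw [mem_closedBall_zero_iff]
      refine (norm_le_of_mem_pseudospectrum hκ ?_ (hμ k)).trans ?_
      · rw [hr]
        linarith
      · gcongr
        exact norm_polyStar_le p (ha k)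
  obtain ⟨ν, -, φ, hφ, hlim⟩ := tendsto_subseq_of_bounded Metric.isBounded_closedBall hbdd
  have hcomm0 : Tendsto (fun k => ‖a k * star (a k) - star (a k) * a k‖) atTop (𝓝 0) :=
    squeeze_zero (fun _ => norm_nonneg _) (fun k => (hcomm k).trans (hδ k).le)
      tendsto_one_div_add_atTop_nhds_zero_nat
  have hdist : ∀ k, ∀ z ∈ holedDisk lam R, κ ≤ ‖polyMap p z - μ k‖ := fun k z hz => by
    by_contra! hlt
    refine hμS k (Metric.mem_thickening_iff.2 ⟨_, Set.mem_image_of_mem _ hz, ?_⟩)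
    rwa [dist_comm, dist_eq_norm]
  obtain ⟨k, d, hd1, hd2, hd⟩ := exists_inverse_along_sequence (A := fun k => A (φ k)) hR p hε hκ
    (fun k => ha (φ k)) (hcomm0.comp hφ.tendsto_atTop) (fun k => hinv (φ k)) hlim
    (fun k => hdist (φ k))
  have := inv_lt_norm_of_mem_pseudospectrum (hμ (φ k)) hd1 hd2
  rw [hr] at this
  linarith
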